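/- Let $p$ be a prime and $G$ a finite $p$-group with exponent-$p$ central series $\eta$: $\eta_0=\eta_1=G$ and $\eta_{i+1}=[G,\eta_i]\,\eta_i^p$ for $i\ge 1$, where $\eta_i^p=\langle x^p : x\in\eta_i\rangle$. Assume that $\dim_{\mathbb Z/p}(\eta_1/\eta_2)$ is odd, that $\dim_{\mathbb Z/p}(\eta_2/\eta_3)=2$, and that the commutation map $\eta_1/\eta_2\times\eta_1/\eta_2\to\eta_2/\eta_3$ is not identically zero, i.e. $[G,G]\not\le\eta_3$. Then $\eta$ has a proper lex-least adjoint refinement. Here a filter on $G$ over a commutative monoid $M$ is a family of subgroups $(\phi_s)_{s\in M}$ with $\phi_0=G$ and $[\phi_s,\phi_t]\le\phi_{s+t}\le\phi_s\cap\phi_t$; the series $\eta$ is a filter over $\mathbb N$. For a filter $\phi$ over $\mathbb N$ put $L_s=\phi_s/\phi_{s+1}$ for $s\geq 1$. Let $s\ge 1$ be least with $L_s\ne 0$, let $[\,,]:L_s\times L_s\to L_{2s}$ be the biadditive map induced by commutators, let $$\mathrm{Adj}=\{(X,Y)\in \mathrm{End}(L_s)\times\mathrm{End}(L_s)^{\mathrm{op}}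 : [uX,v]=[u,Yv]\ \text{ for all } u,v\in L_s\},$$ let $J$ be the Jacobson radical of $\mathrm{Adj}$, and let $\phi_{s+1}\le H_i\le\phi_s$ be given by $H_i/\phi_{s+1}=L_sJ^i$ ($i\ge 0$, $J^0=\mathrm{Adj}$). Order $\mathbb N^2$ lexicographically with the first coordinate dominant, let $X=\{x\in\mathbb N^2 : x<(s+1,0)\}$, and for $(u,i)\in X$ set $\pi_{(u,i)}=\phi_u$ if $i=0$ or $u\ne s$, and $\pi_{(s,i)}=H_i$. The lex-least adjoint refinement of $\phi$ is the family $$\alpha_x=\prod_{\substack{x_1,\dots,x_d\in X,\ d\ge 1\\ x_1+\cdots+x_d=x}}[\pi_{x_1},\dots,\pi_{x_d}]\qquad(x\in\mathbb N^2),$$ with left-normed commutators of subgroups. It is a proper refinement of $\phi$ when $\alpha$ is a filter over $\mathbb N^2$ that is order-reversing for the lexicographic order, $\alpha_{(u,i)}\le\phi_u$ for all $u,i$, $\alpha_{(u,0)}=\phi_u$ for all $u\le s$, $\alpha_{(s,c)}=\phi_{s+1}$ for some $c$, and $\phi_{s+1}<\alpha_{(s,i)}<\phi_s$ (strict inclusions)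 for some $i$. -/

import Mathlib

namespace AdjRefine

/-- A filter on `G` indexed by the commutative monoid `M`: subgroups `φ s` with `φ 0 = G` and
`[φ s, φ t] ≤ φ (s + t) ≤ φ s ∩ φ t`. -/
structure IsFilter {M : Type*} [AddCommMonoid M] {G : Type*} [Group G] (φ : M → Subgroup G) :
    Prop where
  zero : φ 0 = ⊤
  commutator_le : ∀ s t, ⁅φ s, φ t⁆ ≤ φ (s + t)
  le_inf : ∀ s t, φ (s + t) ≤ φ s ⊓ φ t

/-- A filter indexed by `ℕ`. -/
structure NatFilter (G : Type*) [Group G] where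
  toFun : ℕ → Subgroup G
  isFilter : IsFilter toFun

namespace NatFilter

variable {G : Type*} [Group G]

instance : CoeFun (NatFilter G) (fun _ => ℕ → Subgroup G) := ⟨NatFilter.toFun⟩

theorem antitone (φ : NatFilter G) {s t : ℕ} (h : s ≤ t) : φ t ≤ φ s := by
  obtain ⟨k, rfl⟩ := Nat.exists_eq_add_of_le h
  exact (φ.isFilter.le_inf s k).trans inf_le_left

/-- The commutator `x⁻¹ y⁻¹ x y` lies in `φ (s + t)`. -/
theorem comm_mem (φ : NatFilter G) {s t : ℕ} {x y : G} (hx : x ∈ φ s) (hy : y ∈ φ t) :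
    x⁻¹ * y⁻¹ * x * y ∈ φ (s + t) := by
  have h := φ.isFilter.commutator_le s t
    (Subgroup.commutator_mem_commutator ((φ s).inv_mem hx) ((φ t).inv_mem hy))
  simpa [commutatorElement_def] using h

instance normal (φ : NatFilter G) (s : ℕ) : (φ s).Normal := by
  refine ⟨fun n hn g => ?_⟩
  have h := φ.comm_mem (s := 0) (x := g⁻¹) (y := n⁻¹)
    (by rw [φ.isFilter.zero]; trivial) ((φ s).inv_mem hn)
  rw [zero_add, inv_inv, inv_inv] at h
  simpa using (φ s).mul_mem h hn

/-- The homogeneous component `L_s = φ_s / φ_s⁺`, written additively. Over `ℕ` the subgroup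
`φ_s⁺`, generated by all `φ_{s+t}` with `t ≠ 0`, is `φ_{s+1}`. -/
def Layer (φ : NatFilter G) (s : ℕ) : Type _ :=
  Additive (φ s ⧸ (φ (s + 1)).subgroupOf (φ s))

instance (φ : NatFilter G) (s : ℕ) : AddGroup (φ.Layer s) :=
  inferInstanceAs (AddGroup (Additive (φ s ⧸ (φ (s + 1)).subgroupOf (φ s))))

/-- The class in `L_s` of an element of `φ_s`. -/
def toLayer (φ : NatFilter G) (s : ℕ) (x : φ s) : φ.Layer s :=
  Additive.ofMul (QuotientGroup.mk x)

theorem toLayer_surjective (φ : NatFilter G) (s : ℕ) : Function.Surjective (φ.toLayer s) := by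
  intro u
  obtain ⟨x, hx⟩ := QuotientGroup.mk_surjective (Additive.toMul u)
  exact ⟨x, by rw [toLayer, hx]; rfl⟩

theorem toLayer_eq_iff (φ : NatFilter G) (s : ℕ) (x y : φ s) :
    φ.toLayer s x = φ.toLayer s y ↔ (x : G)⁻¹ * y ∈ φ (s + 1) :=
  (QuotientGroup.eq (s := (φ (s + 1)).subgroupOf (φ s)) (a := x) (b := y)).trans Iff.rfl

theorem toLayer_mul (φ : NatFilter G) (s : ℕ) (x y : φ s) :
    φ.toLayer s (x * y) = φ.toLayer s x + φ.toLayer s y := rfl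

/-- The quotient map `φ_s → L_s`, with `L_s` written multiplicatively. -/
def toLayerHom (φ : NatFilter G) (s : ℕ) : φ s →* Multiplicative (φ.Layer s) :=
  MonoidHom.mk' (fun x => Multiplicative.ofAdd (φ.toLayer s x)) (fun _ _ => rfl)

instance (φ : NatFilter G) (s : ℕ) [NeZero s] : AddCommGroup (φ.Layer s) :=
  { (inferInstance : AddGroup (φ.Layer s)) with
    add_comm := by
      intro u v
      obtain ⟨x, rfl⟩ := φ.toLayer_surjective s u
      obtain ⟨y, rfl⟩ := φ.toLayer_surjective s v
      rw [← toLayer_mul, ← toLayer_mul, toLayer_eq_iff]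
      have h := φ.antitone (Nat.add_le_add_left (NeZero.one_le (n := s)) s)
        (φ.comm_mem y.2 x.2)
      simpa [mul_assoc] using h }

/-- The commutator of representatives, as a map `φ_s × φ_t → L_{s+t}`. -/
def commMap (φ : NatFilter G) (s t : ℕ) (x : φ s) (y : φ t) : φ.Layer (s + t) :=
  φ.toLayer (s + t) ⟨(x : G)⁻¹ * (y : G)⁻¹ * x * y, φ.comm_mem x.2 y.2⟩

theorem commMap_mul_left (φ : NatFilter G) (s t : ℕ) [NeZero s] (x x' : φ s) (y : φ t) :
    φ.commMap s t (x * x') y = φ.commMap s t x y + φ.commMap s t x' y := by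
  unfold commMap
  rw [← toLayer_mul, toLayer_eq_iff]
  have hs := NeZero.one_le (n := s)
  have h := φ.comm_mem x'.2 (φ.comm_mem x.2 y.2)
  have h' := φ.antitone (show s + t + 1 ≤ s + (s + t) by omega) h
  have h2 := (φ.normal (s + t + 1)).conj_mem _ h'
    (((x' : G)⁻¹ * (y : G)⁻¹ * x' * y)⁻¹)
  convert h2 using 1
  simp only [Subgroup.coe_mul]
  group

theorem commMap_mul_right (φ : NatFilter G) (s t : ℕ) [NeZero t] (x : φ s) (y y' : φ t) :
    φ.commMap s t x (y * y') = φ.commMap s t x y + φ.commMap s t x y' := by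
  unfold commMap
  rw [← toLayer_mul, toLayer_eq_iff]
  have hs := NeZero.one_le (n := t)
  have h := φ.comm_mem (φ.comm_mem x.2 y.2) (φ.comm_mem x.2 y'.2)
  have h1 := φ.comm_mem y'.2 (φ.comm_mem x.2 y.2)
  have h' := φ.antitone (show s + t + 1 ≤ s + t + (s + t) by omega) h
  have h1' := φ.antitone (show s + t + 1 ≤ t + (s + t) by omega) h1
  convert (φ (s + t + 1)).mul_mem h1' h' using 1
  simp only [Subgroup.coe_mul]
  group

instance neZero_add (s t : ℕ) [NeZero s] : NeZero (s + t) :=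
  ⟨by have := NeZero.ne s; omega⟩

theorem commMap_eq_zero_right (φ : NatFilter G) (s t : ℕ) [NeZero t] (x : φ s) (y : φ t)
    (hy : (y : G) ∈ φ (t + 1)) : φ.commMap s t x y = 0 := by
  refine ((φ.toLayer_eq_iff (s + t) 1 _).2 ?_).symm
  simpa [add_assoc] using φ.comm_mem x.2 hy

theorem commMap_eq_zero_left (φ : NatFilter G) (s t : ℕ) [NeZero s] (x : φ s) (y : φ t)
    (hx : (x : G) ∈ φ (s + 1)) : φ.commMap s t x y = 0 := by
  refine ((φ.toLayer_eq_iff (s + t) 1 _).2 ?_).symm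
  have h := φ.comm_mem hx y.2
  rw [add_right_comm] at h
  simpa using h

/-- The map `L_t → L_{s+t}` induced by `y ↦ [x, y]`, for a fixed `x ∈ φ_s`. -/
def bracketRight (φ : NatFilter G) (s t : ℕ) [NeZero s] [NeZero t] (x : φ s) :
    φ.Layer t →+ φ.Layer (s + t) :=
  MonoidHom.toAdditiveLeft <| QuotientGroup.lift _
    (MonoidHom.mk' (fun y : φ t => Multiplicative.ofAdd (φ.commMap s t x y))
      (fun y y' => congrArg Multiplicative.ofAdd (φ.commMap_mul_right s t x y y')))
    (fun y hy => congrArg Multiplicative.ofAdd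
      (φ.commMap_eq_zero_right s t x y (Subgroup.mem_subgroupOf.1 hy)))

theorem bracketRight_toLayer (φ : NatFilter G) (s t : ℕ) [NeZero s] [NeZero t] (x : φ s)
    (y : φ t) : φ.bracketRight s t x (φ.toLayer t y) = φ.commMap s t x y := rfl

/-- The graded product `[,] : L_s × L_t → L_{s+t}`, induced by commutators. -/
def bracket (φ : NatFilter G) (s t : ℕ) [NeZero s] [NeZero t] :
    φ.Layer s →+ φ.Layer t →+ φ.Layer (s + t) :=
  MonoidHom.toAdditiveLeft <| QuotientGroup.lift _
    (MonoidHom.mk' (fun x : φ s => Multiplicative.ofAdd (φ.bracketRight s t x))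
      (fun x x' => congrArg Multiplicative.ofAdd <| by
        refine DFunLike.ext _ _ fun v => ?_
        obtain ⟨y, rfl⟩ := φ.toLayer_surjective t v
        exact φ.commMap_mul_left s t x x' y))
    (fun x hx => congrArg Multiplicative.ofAdd <| by
        refine DFunLike.ext _ _ fun v => ?_
        obtain ⟨y, rfl⟩ := φ.toLayer_surjective t v
        exact φ.commMap_eq_zero_left s t x y (Subgroup.mem_subgroupOf.1 hx))

theorem bracket_toLayer (φ : NatFilter G) (s t : ℕ) [NeZero s] [NeZero t] (x : φ s) (y : φ t) :
    φ.bracket s t (φ.toLayer s x) (φ.toLayer t y) =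
      φ.toLayer (s + t) ⟨(x : G)⁻¹ * (y : G)⁻¹ * x * y, φ.comm_mem x.2 y.2⟩ := rfl

/-- The ring of adjoints of `[,] : L_s × L_t → L_{s+t}`: the pairs `(X, Y)` in
`End L_s × (End L_t)ᵒᵖ` with `[X u, v] = [u, Y v]`. Endomorphisms act on the left here; writing
them on the right instead gives the opposite ring, which has the same Jacobson radical and the
same powers of it. -/
def Adj (φ : NatFilter G) (s t : ℕ) [NeZero s] [NeZero t] :
    Subring (AddMonoid.End (φ.Layer s) × (AddMonoid.End (φ.Layer t))ᵐᵒᵖ) where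
  carrier := {A | ∀ (u : φ.Layer s) (v : φ.Layer t),
    φ.bracket s t (A.1 u) v = φ.bracket s t u (A.2.unop v)}
  one_mem' := fun _ _ => rfl
  mul_mem' := fun {A B} hA hB u v => (hA (B.1 u) v).trans (hB u (A.2.unop v))
  zero_mem' := fun u v => by
    change φ.bracket s t 0 v = φ.bracket s t u 0
    simp
  add_mem' := fun {A B} hA hB u v => by
    change φ.bracket s t (A.1 u + B.1 u) v = φ.bracket s t u (A.2.unop v + B.2.unop v)
    rw [map_add, map_add, AddMonoidHom.add_apply, hA, hB]
  neg_mem' := fun {A} hA u v => by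
    change φ.bracket s t (-(A.1 u)) v = φ.bracket s t u (-(A.2.unop v))
    rw [map_neg, map_neg, AddMonoidHom.neg_apply, hA]

/-- The ring of adjoints as a type. -/
def AdjRing (φ : NatFilter G) (s t : ℕ) [NeZero s] [NeZero t] : Type _ := φ.Adj s t

instance (φ : NatFilter G) (s t : ℕ) [NeZero s] [NeZero t] : Ring (φ.AdjRing s t) :=
  inferInstanceAs (Ring (φ.Adj s t))

/-- The action of the ring of adjoints of `[,] : L_s × L_t → L_{s+t}` on `L_s`,
`(X, Y) ↦ X`. -/
def actLeft (φ : NatFilter G) (s t : ℕ) [NeZero s] [NeZero t] :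
    φ.AdjRing s t →+* AddMonoid.End (φ.Layer s) :=
  (RingHom.fst _ _).comp (φ.Adj s t).subtype

/-- The subgroup `L_s Jⁱ` of `L_s`, for `J` the Jacobson radical of the ring of adjoints of
`[,] : L_s × L_s → L_{2s}`. -/
def radLayer (φ : NatFilter G) (s : ℕ) [NeZero s] (i : ℕ) : AddSubgroup (φ.Layer s) :=
  AddSubgroup.closure {w | ∃ A ∈ Ring.jacobson (φ.AdjRing s s) ^ i, ∃ u : φ.Layer s,
    φ.actLeft s s A u = w}

/-- The subgroup `H_i` with `φ_s⁺ ≤ H_i ≤ φ_s` and `H_i / φ_s⁺ = L_s Jⁱ`. -/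
def H (φ : NatFilter G) (s : ℕ) [NeZero s] (i : ℕ) : Subgroup G :=
  ((AddSubgroup.toSubgroup (φ.radLayer s i)).comap (φ.toLayerHom s)).map (φ s).subtype

theorem mem_H (φ : NatFilter G) (s : ℕ) [NeZero s] (i : ℕ) (g : G) :
    g ∈ φ.H s i ↔ ∃ h : g ∈ φ s, φ.toLayer s ⟨g, h⟩ ∈ φ.radLayer s i := by
  constructor
  · rintro ⟨x, hx, rfl⟩
    exact ⟨x.2, hx⟩
  · rintro ⟨h, hx⟩
    exact ⟨⟨g, h⟩, hx, rfl⟩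

/-- The function to be extended to a filter: `φ_u` if `i = 0` or `u ≠ s`, and `H_i` if `u = s`. -/
def preAdjoint (φ : NatFilter G) (s : ℕ) [NeZero s] (x : ℕ ×ₗ ℕ) : Subgroup G :=
  if (ofLex x).2 = 0 ∨ (ofLex x).1 ≠ s then φ (ofLex x).1 else φ.H s (ofLex x).2

end NatFilter

/-- The left-normed commutator `[A₁, …, A_d] = [[A₁, …, A_{d-1}], A_d]` of a nonempty list of
subgroups, given by its first member and the list of the others. -/
def iterComm {G : Type*} [Group G] (A : Subgroup G) (l : List (Subgroup G)) : Subgroup G :=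
  l.foldl (fun B C => ⁅B, C⁆) A

/-- The function `M → 2^G` generated by `π : X → 2^G`, where `X` generates the monoid `M`: its
value at `s` is the product of `[π_{s₁}, …, π_{s_d}]` over all nonempty sequences
`s₁, …, s_d` in `X` with sum `s`. -/
def generate {M : Type*} [AddCommMonoid M] {G : Type*} [Group G] (X : Set M)
    (π : M → Subgroup G) (s : M) : Subgroup G :=
  ⨆ (a : M) (l : List M) (_ : (∀ b ∈ a :: l, b ∈ X) ∧ (a :: l).sum = s),
    iterComm (π a) (l.map π)

/-- The filter on `ℕ × ℕ` (lexicographic order, first coordinate dominant) generated by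
the function `NatFilter.preAdjoint` on the set of all indices below `(s + 1, 0)`. -/
def adjointFilter {G : Type*} [Group G] (φ : NatFilter G) (s : ℕ) [NeZero s] :
    ℕ ×ₗ ℕ → Subgroup G :=
  generate {x | x < toLex (s + 1, 0)} (φ.preAdjoint s)

/-- `s` is the least nonzero index with `L_s ≠ 0`. -/
def IsFirstLayer {G : Type*} [Group G] (φ : NatFilter G) (s : ℕ) : Prop :=
  IsLeast {t : ℕ | t ≠ 0 ∧ φ t ≠ φ (t + 1)} s

/-- `α` is a proper refinement of `φ` in the component `s`: a filter that descends along the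
lexicographic order, agrees with `φ` down to `φ_s`, takes values strictly between `φ_s` and
`φ_{s+1}` and reaches `φ_{s+1}` inside the component `s`, and stays below `φ` throughout. -/
structure IsProperRefinement {G : Type*} [Group G] (φ : NatFilter G) (s : ℕ)
    (α : ℕ ×ₗ ℕ → Subgroup G) : Prop where
  isFilter : IsFilter α
  antitone : Antitone α
  le : ∀ u i, α (toLex (u, i)) ≤ φ u
  eq : ∀ u ≤ s, α (toLex (u, 0)) = φ u
  eventually_eq : ∃ c, α (toLex (s, c)) = φ (s + 1)
  proper : ∃ i, φ (s + 1) < α (toLex (s, i)) ∧ α (toLex (s, i)) < φ s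

/-- `φ` has a proper lex-least adjoint refinement. -/
def HasProperLexLeastAdjointRefinement {G : Type*} [Group G] (φ : NatFilter G) : Prop :=
  ∃ (s : ℕ) (_ : NeZero s), IsFirstLayer φ s ∧ IsProperRefinement φ s (adjointFilter φ s)

/-- The terms of the exponent-`p` central series `η` of `G`: `η₀ = η₁ = G` and
`η_{i+1} = [G, η_i] η_i^p` for `i > 0`. -/
def etaTerm (p : ℕ) (G : Type*) [Group G] : ℕ → Subgroup G
  | 0 => ⊤
  | 1 => ⊤
  | i + 2 => ⁅(⊤ : Subgroup G), etaTerm p G (i + 1)⁆ ⊔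
      Subgroup.closure {y | ∃ x ∈ etaTerm p G (i + 1), x ^ p = y}

theorem pow_mem_etaTerm (p : ℕ) (G : Type*) [Group G] {i : ℕ} (hi : i ≠ 0) {x : G}
    (hx : x ∈ etaTerm p G i) : x ^ p ∈ etaTerm p G (i + 1) := by
  obtain ⟨k, rfl⟩ := Nat.exists_eq_succ_of_ne_zero hi
  exact Subgroup.mem_sup_right (Subgroup.subset_closure ⟨x, hx, rfl⟩)

theorem comm_top_etaTerm (p : ℕ) (G : Type*) [Group G] (i : ℕ) :
    ⁅(⊤ : Subgroup G), etaTerm p G i⁆ ≤ etaTerm p G (i + 1) := by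
  cases i with
  | zero => exact le_top
  | succ k => exact le_sup_left

theorem etaTerm_normal (p : ℕ) (G : Type*) [Group G] (i : ℕ) : (etaTerm p G i).Normal := by
  induction i using Nat.strong_induction_on with
  | _ i ih =>
    match i, ih with
    | 0, _ => exact inferInstanceAs (⊤ : Subgroup G).Normal
    | 1, _ => exact inferInstanceAs (⊤ : Subgroup G).Normal
    | k + 2, ih =>
      have := ih (k + 1) (by omega)
      have : (Subgroup.closure {y | ∃ x ∈ etaTerm p G (k + 1), x ^ p = y}).Normal := by
        refine ⟨fun n hn g => ?_⟩
        induction hn using Subgroup.closure_induction with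
        | mem y hy =>
          obtain ⟨x, hx, rfl⟩ := hy
          exact Subgroup.subset_closure ⟨g * x * g⁻¹, this.conj_mem x hx g, conj_pow⟩
        | one => simp
        | mul a b _ _ ha hb => simpa [mul_assoc] using mul_mem ha hb
        | inv a _ ha => simpa [mul_assoc] using inv_mem ha
      exact Subgroup.sup_normal _ _

theorem etaTerm_succ_le (p : ℕ) (G : Type*) [Group G] (i : ℕ) :
    etaTerm p G (i + 1) ≤ etaTerm p G i := by
  match i with
  | 0 => exact le_top
  | k + 1 =>
    have := etaTerm_normal p G (k + 1)
    refine sup_le (Subgroup.commutator_le_right _ _) ((Subgroup.closure_le _).2 ?_)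
    rintro _ ⟨x, hx, rfl⟩
    exact pow_mem hx p

theorem etaTerm_antitone (p : ℕ) (G : Type*) [Group G] : Antitone (etaTerm p G) :=
  antitone_nat_of_succ_le (etaTerm_succ_le p G)

/-- The commutator of `A` and `B` lies in the normal subgroup `N` exactly when the images of `A`
and `B` in `G ⧸ N` commute. -/
theorem commutator_le_iff_map {G : Type*} [Group G] (A B N : Subgroup G) [N.Normal] :
    ⁅A, B⁆ ≤ N ↔ ⁅A.map (QuotientGroup.mk' N), B.map (QuotientGroup.mk' N)⁆ = ⊥ := by
  rw [← Subgroup.map_commutator, Subgroup.map_eq_bot_iff, QuotientGroup.ker_mk']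

theorem etaTerm_commutator_le (p : ℕ) (G : Type*) [Group G] (j i : ℕ) :
    ⁅etaTerm p G i, etaTerm p G j⁆ ≤ etaTerm p G (i + j) := by
  induction j generalizing i with
  | zero =>
    have := etaTerm_normal p G i
    exact Subgroup.commutator_le_left _ _
  | succ j ih =>
    rcases j with _ | k
    · rw [Subgroup.commutator_comm]
      exact comm_top_etaTerm p G i
    · rcases Nat.eq_zero_or_pos i with rfl | hi
      · have := etaTerm_normal p G (k + 1 + 1)
        rw [zero_add]
        exact Subgroup.commutator_le_right _ _
      have hN := etaTerm_normal p G (i + (k + 1 + 1))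
      rw [commutator_le_iff_map, Subgroup.commutator_comm,
        Subgroup.commutator_eq_bot_iff_le_centralizer, Subgroup.map_le_iff_le_comap]
      refine sup_le ?_ ((Subgroup.closure_le _).2 ?_)
      · rw [← Subgroup.map_le_iff_le_comap, ← Subgroup.commutator_eq_bot_iff_le_centralizer,
          Subgroup.map_commutator]
        apply Subgroup.commutator_commutator_eq_bot_of_rotate
        · rw [← Subgroup.map_commutator, ← commutator_le_iff_map]
          have h := Subgroup.commutator_mono (ih i) (le_refl (⊤ : Subgroup G))
          rw [Subgroup.commutator_comm (etaTerm p G i)] at h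
          refine h.trans ?_
          rw [Subgroup.commutator_comm]
          exact comm_top_etaTerm p G _
        · rw [← Subgroup.map_commutator, ← commutator_le_iff_map, Subgroup.commutator_comm _ ⊤]
          refine (Subgroup.commutator_mono (comm_top_etaTerm p G i) le_rfl).trans ?_
          refine (ih (i + 1)).trans (le_of_eq ?_)
          congr 1
          omega
      · rintro _ ⟨y, hy, rfl⟩
        rw [SetLike.mem_coe, Subgroup.mem_comap, Subgroup.mem_centralizer_iff]
        rintro _ ⟨x, hx, rfl⟩
        have hc : x * y * x⁻¹ * y⁻¹ ∈ etaTerm p G (i + (k + 1)) := ih i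
          (Subgroup.commutator_mem_commutator hx hy)
        have hp := pow_mem_etaTerm p G (by omega) hc
        have hcen : ∀ g : G, Commute (QuotientGroup.mk' (etaTerm p G (i + (k + 1 + 1))) g)
            (QuotientGroup.mk' _ (x * y * x⁻¹ * y⁻¹)) := by
          intro g
          have h := (commutator_le_iff_map ⊤ _ _).1 (comm_top_etaTerm p G (i + (k + 1)))
          rw [Subgroup.commutator_eq_bot_iff_le_centralizer] at h
          exact (Subgroup.mem_centralizer_iff.1 (h ⟨g, trivial, rfl⟩) _ ⟨_, hc, rfl⟩).symm
        have hone : (QuotientGroup.mk' (etaTerm p G (i + (k + 1 + 1))) (x * y * x⁻¹ * y⁻¹)) ^ p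
            = 1 := by
          rw [← map_pow]
          exact (QuotientGroup.eq_one_iff _).2 hp
        have hconj : (QuotientGroup.mk' (etaTerm p G (i + (k + 1 + 1))) (x * y * x⁻¹)) ^ p =
            (QuotientGroup.mk' (etaTerm p G (i + (k + 1 + 1))) y) ^ p := by
          have h : x * y * x⁻¹ = (x * y * x⁻¹ * y⁻¹) * y := by group
          rw [h, map_mul, (hcen y).symm.mul_pow, hone, one_mul]
        rw [← map_pow, ← map_pow, conj_pow, map_mul, map_inv, mul_inv_eq_iff_eq_mul] at hconj
        rw [← map_mul]
        exact hconj

theorem eta_isFilter (p : ℕ) (G : Type*) [Group G] : IsFilter (etaTerm p G) where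
  zero := rfl
  commutator_le := fun s t => etaTerm_commutator_le p G t s
  le_inf := fun s t => le_inf (etaTerm_antitone p G (Nat.le_add_right s t))
    (etaTerm_antitone p G (Nat.le_add_left t s))

/-- The exponent-`p` central series `η` of `G`, as a filter on `ℕ`. -/
def eta (p : ℕ) (G : Type*) [Group G] : NatFilter G := ⟨etaTerm p G, eta_isFilter p G⟩

/-- For `s > 0` the component `η_s / η_{s+1}` is a vector space over `ℤ/pℤ`. -/
instance (p : ℕ) (G : Type*) [Group G] (s : ℕ) [NeZero s] :
    Module (ZMod p) ((eta p G).Layer s) :=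
  AddCommGroup.zmodModule <| by
    intro u
    obtain ⟨x, rfl⟩ := (eta p G).toLayer_surjective s u
    refine (((eta p G).toLayer_eq_iff s 1 (x ^ p)).2 ?_).symm
    have h : (x : G) ^ p ∈ eta p G (s + 1) := pow_mem_etaTerm p G (NeZero.ne s) x.2
    simpa using h

end AdjRefine

/-! In coordinates on the plane `L₂`, the bracket on `L₁` is a pair of alternating forms `c₀`, `c₁`.
As `dim L₁` is odd, so is the dimension of the radical of `c₀`, and hence `c₁` degenerates on that
radical: some `f ≠ 0` lies in the radical of `c₀` and is `c₁`-orthogonal to all of it. The rank one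
maps `u ↦ c₁(u, f) f` and `v ↦ c₁(f, v) f` form an adjoint pair; if `f` is central for the bracket,
`(u ↦ cᵢ(u, w) f, 0)` replaces it. Either pair generates an ideal of square zero
(`exists_adjoint_pair`), so it lies in the radical `J` of the adjoint ring and `L₁J ≠ 0`. The
adjoint ring is finite, so `J` is nilpotent and `L₁J ≠ L₁`. Thus `H₁` lies strictly between `η₂` and
`η₁`. The generated family is a filter by the three subgroups lemma
(`commutator_generate_generate_le`) and descends lexicographically because bounds can be split along
sums (`generate_antitone`). In component 1 it adds nothing to the `H_i` (`adjointFilter_one_eq`), so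
the strict inclusions survive. -/

namespace AdjRefine

/-! ### Pairs of alternating forms in odd dimension -/

section LinearAlgebra

open Matrix

/-- The difference of a square matrix of odd size and its transpose is singular. -/
theorem det_sub_transpose_eq_zero {R n : Type*} [CommRing R] [Fintype n] [DecidableEq n]
    (hn : Odd (Fintype.card n)) (M : Matrix n n R) : (M - Mᵀ).det = 0 := by
  -- For the generic matrix over `ℤ`, `det = -det` forces `det = 0`. Specialising gives the result
  -- in characteristic 2 as well, where `det = -det` says nothing.
  have generic : ((mvPolynomialX n n ℤ) - (mvPolynomialX n n ℤ)ᵀ).det = 0 := by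
    rw [← self_eq_neg (a := ((mvPolynomialX n n ℤ) - (mvPolynomialX n n ℤ)ᵀ).det)]
    conv_lhs => rw [← det_transpose, transpose_sub, transpose_transpose, ← neg_sub, det_neg,
      hn.neg_one_pow, neg_one_mul]
  have h := congrArg (MvPolynomial.eval₂Hom (Int.castRingHom R) fun q : n × n => M q.1 q.2) generic
  rw [RingHom.map_det, map_zero] at h
  convert! h using 2
  ext i j
  simp [mvPolynomialX]

variable {K V : Type*} [Field K] [AddCommGroup V] [Module K V]

/-- An alternating form on a space of odd dimension is degenerate. -/
theorem exists_ne_zero_of_isAlt_of_odd (b : V →ₗ[K] V →ₗ[K] K) (hb : b.IsAlt)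
    (hV : Odd (Module.finrank K V)) : ∃ v ≠ 0, ∀ w, b v w = 0 := by
  have : FiniteDimensional K V := Module.finite_of_finrank_pos hV.pos
  let e := Module.finBasis K V
  let A : Matrix (Fin (Module.finrank K V)) (Fin (Module.finrank K V)) K :=
    Matrix.of fun i j => b (e i) (e j)
  -- The Gram matrix is its strict upper triangle minus the transpose; the diagonal vanishes because
  -- the form is alternating, not merely skew.
  have hA : A = (Matrix.of fun i j => if i < j then b (e i) (e j) else 0) -
      (Matrix.of fun i j => if i < j then b (e i) (e j) else 0)ᵀ := by
    ext i j
    rcases lt_trichotomy i j with h | rfl | h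
    · simp [A, h, h.not_gt]
    · simpa [A] using hb _
    · simp [A, h, h.not_gt, hb.neg]
  have hdet : A.det = 0 := by
    rw [hA]
    exact det_sub_transpose_eq_zero (by simpa using hV) _
  obtain ⟨c, hc, h⟩ := Matrix.exists_vecMul_eq_zero_iff.2 hdet
  refine ⟨∑ i, c i • e i, fun h0 => hc ?_, fun w => ?_⟩
  · ext i
    exact Fintype.linearIndependent_iff.1 e.linearIndependent c h0 i
  · have : b (∑ i, c i • e i) = 0 := e.ext fun j => by
      simpa [A, Matrix.vecMul, dotProduct] using congrFun h j
    rw [this, LinearMap.zero_apply]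

/-- For two alternating forms on a space of odd dimension, the second one is degenerate on the
radical of the first one. -/
theorem exists_ne_zero_of_isAlt_of_isAlt_of_odd (b₁ b₂ : V →ₗ[K] V →ₗ[K] K) (h₁ : b₁.IsAlt)
    (h₂ : b₂.IsAlt) (hV : Odd (Module.finrank K V)) :
    ∃ f ≠ 0, b₁ f = 0 ∧ ∀ k, b₁ k = 0 → b₂ f k = 0 := by
  have : FiniteDimensional K V := Module.finite_of_finrank_pos hV.pos
  obtain ⟨C, hC⟩ := Submodule.exists_isCompl (LinearMap.ker b₁)
  -- The form is nondegenerate on a complement of its radical: a vector of `C` orthogonal to `C` is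
  -- orthogonal to everything, hence in the radical. So `C` cannot have odd dimension.
  have heven : ¬ Odd (Module.finrank K C) := by
    intro hodd
    obtain ⟨v, hv, h⟩ := exists_ne_zero_of_isAlt_of_odd (b₁.domRestrict₁₂ C C)
      (fun x => h₁ x) hodd
    apply hv
    have hk : (v : V) ∈ LinearMap.ker b₁ := by
      refine LinearMap.mem_ker.2 (LinearMap.ext fun w => ?_)
      obtain ⟨k, hk, c, hc, rfl⟩ := Submodule.mem_sup.1 (hC.sup_eq_top ▸ Submodule.mem_top : w ∈ _)
      have h1 : b₁ v k = 0 := h₁.eq_iff.1 (by rw [LinearMap.mem_ker.1 hk, LinearMap.zero_apply])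
      have h2 : b₁ v c = 0 := h ⟨c, hc⟩
      rw [map_add, h1, h2, add_zero, LinearMap.zero_apply]
    exact Subtype.ext ((Submodule.disjoint_def.1 hC.disjoint) _ hk v.2)
  have hodd : Odd (Module.finrank K (LinearMap.ker b₁)) := by
    have h := Submodule.finrank_add_eq_of_isCompl hC
    rw [← h] at hV
    exact (Nat.odd_add.1 hV).2 (Nat.not_odd_iff_even.1 heven)
  obtain ⟨f, hf, h⟩ := exists_ne_zero_of_isAlt_of_odd
    (b₂.domRestrict₁₂ (LinearMap.ker b₁) (LinearMap.ker b₁)) (fun x => h₂ x) hodd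
  exact ⟨f, fun h0 => hf (Subtype.ext h0), f.2, fun k hk => h ⟨k, hk⟩⟩

/-- A nonzero alternating map from a space of odd dimension to a space of dimension two has an
adjoint pair `(X, Y)` with `X ≠ 0` that generates an ideal of square zero. -/
theorem exists_adjoint_pair {W : Type*} [AddCommGroup W] [Module K W] (b : V →ₗ[K] V →ₗ[K] W)
    (hb : ∀ v, b v v = 0) (hne : b ≠ 0) (hV : Odd (Module.finrank K V))
    (hW : Module.finrank K W = 2) :
    ∃ X Y : V →ₗ[K] V, X ≠ 0 ∧ (∀ u v, b (X u) v = b u (Y v)) ∧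
      ∀ A B : V → V, (∀ u v, b (A u) v = b u (B v)) →
        (∀ u, X (A (X u)) = 0) ∧ ∀ v, Y (B (Y v)) = 0 := by
  have : FiniteDimensional K W := Module.finite_of_finrank_pos (by omega)
  let e := Module.finBasisOfFinrankEq K W hW
  let c : Fin 2 → V →ₗ[K] V →ₗ[K] K := fun i => b.compr₂ (e.coord i)
  have hc : ∀ i u v, c i u v = e.coord i (b u v) := fun _ _ _ => rfl
  have hext : ∀ x y : W, e.coord 0 x = e.coord 0 y → e.coord 1 x = e.coord 1 y → x = y := by
    intro x y h0 h1
    refine e.ext_elem fun i => ?_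
    fin_cases i
    exacts [h0, h1]
  have halt : ∀ i, (c i).IsAlt := fun i v => by rw [hc, hb, map_zero]
  obtain ⟨f, hf, hf1, hf2⟩ := exists_ne_zero_of_isAlt_of_isAlt_of_odd (c 0) (c 1) (halt 0) (halt 1)
    hV
  have hf1' : ∀ u, c 0 u f = 0 := fun u => (halt 0).eq_iff.1 (by rw [hf1, LinearMap.zero_apply])
  have hsmul : ∀ (g : V →ₗ[K] K) u, g.smulRight f u = g u • f := fun _ _ => rfl
  by_cases hrad : c 1 f = 0
  · have hbf : ∀ u, b u f = 0 := fun u => by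
      refine hext _ _ ?_ ?_
      · rw [← hc, hf1', map_zero]
      · rw [← hc, map_zero]
        exact (halt 1).eq_iff.1 (by rw [hrad, LinearMap.zero_apply])
    have hfb : ∀ u, b f u = 0 := fun u => by
      refine hext _ _ ?_ ?_
      · rw [← hc, hf1, map_zero, LinearMap.zero_apply]
      · rw [← hc, hrad, map_zero, LinearMap.zero_apply]
    obtain ⟨i, w, hiw⟩ : ∃ i w, (c i).flip w ≠ 0 := by
      by_contra! h
      refine hne (LinearMap.ext₂ fun u v => ?_)
      refine e.ext_elem fun i => ?_
      have := LinearMap.congr_fun (h i v) u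
      rw [LinearMap.flip_apply, hc] at this
      simpa using this
    -- Since `f` brackets trivially with everything, a map with image in the line of `f` has adjoint
    -- 0. Any nonzero functional `c i (·, w)` will do, as the adjoint relation moves `A` off `f` and
    -- makes it vanish at `A (a • f)`.
    refine ⟨((c i).flip w).smulRight f, 0, fun h0 => hiw ?_, fun u v => ?_, fun A B hAB =>
      ⟨fun u => ?_, fun v => rfl⟩⟩
    · ext u
      have := LinearMap.congr_fun h0 u
      rw [hsmul] at this
      simpa [hf] using this
    · rw [hsmul, map_smul, LinearMap.smul_apply, hfb, smul_zero, LinearMap.zero_apply, map_zero]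
    · rw [hsmul, hsmul, LinearMap.flip_apply, hc, hAB, map_smul, LinearMap.smul_apply, hfb,
        smul_zero, map_zero, zero_smul]
  -- Both sides of the adjoint relation vanish under `c 0`, and under `c 1` both equal `c 1 u f * c
  -- 1 f v`.
  · refine ⟨((c 1).flip f).smulRight f, (c 1 f).smulRight f, fun h0 => hrad ?_, fun u v => ?_,
      fun A B hAB => ?_⟩
    · ext u
      have := LinearMap.congr_fun h0 u
      rw [hsmul] at this
      exact (halt 1).eq_iff.1 (by simpa [hf] using this)
    · refine hext _ _ ?_ ?_
      · rw [← hc, ← hc, hsmul, hsmul, map_smul, map_smul, hf1', hf1, smul_zero, smul_zero,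
          LinearMap.zero_apply]
      · rw [← hc, ← hc, hsmul, hsmul, map_smul, map_smul, LinearMap.smul_apply,
          LinearMap.flip_apply, smul_eq_mul, smul_eq_mul, mul_comm]
    -- Adjoint pairs carry multiples of `f` into the radical of `c 0`, to which `f` is `c
    -- 1`-orthogonal. This kills the scalars in `X A X` and `Y B Y`, without additivity of `A` and
    -- `B`.
    · have hA : ∀ a : K, c 0 (A (a • f)) = 0 := fun a => by
        ext v
        rw [hc, hAB, ← hc, map_smul, hf1, smul_zero]
        rfl
      have hB : ∀ a : K, c 0 (B (a • f)) = 0 := fun a => by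
        ext v
        refine (halt 0).eq_iff.1 ?_
        rw [hc, ← hAB, ← hc, map_smul, hf1', smul_zero]
      constructor
      · intro u
        rw [hsmul, hsmul, LinearMap.flip_apply, (halt 1).eq_iff.1 (hf2 _ (hA _)), zero_smul]
      · intro v
        rw [hsmul, hsmul, hf2 _ (hB _), zero_smul]

end LinearAlgebra

/-! ### The Jacobson radical -/

section Ring

/-- An element that generates an ideal of square zero lies in the Jacobson radical. -/
theorem mem_jacobson_of_mul_mul_eq_zero {R : Type*} [Ring R] (x : R) (h : ∀ a, x * a * x = 0) :
    x ∈ Ring.jacobson R := by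
  rw [← Ideal.jacobson_bot, Ideal.mem_jacobson_iff]
  intro y
  -- As `(y * x)² = 0`, this is the inverse of `1 + y * x`.
  refine ⟨1 - y * x, ?_⟩
  rw [Ideal.mem_bot]
  have := h y
  calc (1 - y * x) * y * x + (1 - y * x) - 1 = - (y * (x * y * x)) := by noncomm_ring
    _ = 0 := by rw [this, mul_zero, neg_zero]

theorem isNilpotent_jacobson_of_finite (R : Type*) [Ring R] [Finite R] :
    IsNilpotent (Ring.jacobson R) := by
  rw [← Ideal.jacobson_bot]
  exact IsArtinianRing.isNilpotent_jacobson_bot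

end Ring


/-! ### Generated families satisfy the commutator condition -/

section Generate

variable {G : Type*} [Group G]

/-- For a normal subgroup `N`, the subgroups `A` with `[A, B] ≤ N` are those below a fixed one. -/
theorem exists_forall_commutator_le_iff (B N : Subgroup G) [N.Normal] :
    ∃ C : Subgroup G, ∀ A : Subgroup G, ⁅A, B⁆ ≤ N ↔ A ≤ C :=
  ⟨_, fun A => by
    rw [commutator_le_iff_map, Subgroup.commutator_eq_bot_iff_le_centralizer,
      Subgroup.map_le_iff_le_comap]⟩

/-- The three subgroups lemma modulo a normal subgroup. -/
theorem commutator_commutator_le_of_rotate {A B C N : Subgroup G} [N.Normal]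
    (h₁ : ⁅⁅A, B⁆, C⁆ ≤ N) (h₂ : ⁅⁅A, C⁆, B⁆ ≤ N) : ⁅A, ⁅B, C⁆⁆ ≤ N := by
  rw [Subgroup.commutator_comm A C] at h₂
  rw [Subgroup.commutator_comm]
  rw [commutator_le_iff_map, Subgroup.map_commutator] at *
  exact Subgroup.commutator_commutator_eq_bot_of_rotate h₂ h₁

theorem iterComm_append_singleton (A : Subgroup G) (l : List (Subgroup G)) (B : Subgroup G) :
    iterComm A (l ++ [B]) = ⁅iterComm A l, B⁆ := by
  simp [iterComm]

theorem iterComm_normal (A : Subgroup G) (l : List (Subgroup G)) (hA : A.Normal)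
    (hl : ∀ B ∈ l, B.Normal) : (iterComm A l).Normal := by
  induction l using List.reverseRecOn with
  | nil => exact hA
  | append_singleton l B ih =>
    rw [iterComm_append_singleton]
    have := ih fun C hC => hl C (by simp [hC])
    have := hl B (by simp)
    infer_instance

variable {M : Type*} [AddCommMonoid M] (X : Set M) (π : M → Subgroup G)

theorem iterComm_le_generate {a : M} {l : List M} (h : ∀ b ∈ a :: l, b ∈ X) :
    iterComm (π a) (l.map π) ≤ generate X π (a :: l).sum :=
  le_iSup_of_le a <| le_iSup_of_le l <| le_iSup_of_le ⟨h, rfl⟩ le_rfl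

theorem le_generate {a : M} (h : a ∈ X) : π a ≤ generate X π a := by
  have := iterComm_le_generate X π (a := a) (l := []) (by simpa using h)
  simpa [iterComm] using this

theorem generate_le {s : M} {N : Subgroup G}
    (h : ∀ (a : M) (l : List M), (∀ b ∈ a :: l, b ∈ X) → (a :: l).sum = s →
      iterComm (π a) (l.map π) ≤ N) : generate X π s ≤ N :=
  iSup_le fun a => iSup_le fun l => iSup_le fun hl => h a l hl.1 hl.2

theorem generate_normal (hπ : ∀ a, (π a).Normal) (s : M) : (generate X π s).Normal := by
  have (a : M) (l : List M) : (iterComm (π a) (l.map π)).Normal :=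
    iterComm_normal _ _ (hπ a) (by simpa using fun b _ => hπ b)
  unfold generate
  infer_instance

/-- To bound `[generate X π s, B]` by a normal subgroup, it suffices to bound the commutators of
the generating subgroups with `B`. -/
theorem commutator_generate_le {s : M} {B N : Subgroup G} [N.Normal]
    (h : ∀ (a : M) (l : List M), (∀ b ∈ a :: l, b ∈ X) → (a :: l).sum = s →
      ⁅iterComm (π a) (l.map π), B⁆ ≤ N) : ⁅generate X π s, B⁆ ≤ N := by
  obtain ⟨C, hC⟩ := exists_forall_commutator_le_iff B N
  rw [hC]
  exact generate_le X π fun a l hl hs => (hC _).1 (h a l hl hs)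

/-- Bracketing a left-normed commutator with `π c` just appends `c` to its index sequence. -/
theorem commutator_generate_le_generate_add (hπ : ∀ a, (π a).Normal) (s : M) {c : M}
    (hc : c ∈ X) : ⁅generate X π s, π c⁆ ≤ generate X π (s + c) := by
  have := generate_normal X π hπ (s + c)
  refine commutator_generate_le X π fun a l hl hs => ?_
  subst hs
  have h := iterComm_le_generate X π (a := a) (l := l ++ [c]) (by
    intro b hb
    simp only [List.mem_cons, List.mem_append, List.not_mem_nil, or_false] at hb hl
    grind)
  rw [List.map_append, List.map_singleton, iterComm_append_singleton] at h
  convert! h using 2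
  simp [add_assoc]

/-- Induction on the right-hand sequence. With `B` the shorter commutator and `C = π c`, the three
subgroups lemma reduces `[A, [B, C]]` to `[[A, B], C]` and `[[A, C], B]`. In the second, `[A, C]` is
again a left-normed commutator, so the induction must allow `A` and `s` to vary. -/
theorem commutator_iterComm_iterComm_le (hπ : ∀ a, (π a).Normal) (b : M) (m : List M)
    (hm : ∀ d ∈ b :: m, d ∈ X) (s : M) (A : Subgroup G) (hA : ∃ a l, (∀ d ∈ a :: l, d ∈ X) ∧
      (a :: l).sum = s ∧ iterComm (π a) (l.map π) = A) :
    ⁅A, iterComm (π b) (m.map π)⁆ ≤ generate X π (s + (b :: m).sum) := by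
  induction m using List.reverseRecOn generalizing s A with
  | nil =>
    obtain ⟨a, l, hl, rfl, rfl⟩ := hA
    have h := commutator_generate_le_generate_add X π hπ (a :: l).sum (hm b (by simp))
    simpa [iterComm] using
      (Subgroup.commutator_mono (iterComm_le_generate X π hl) le_rfl).trans h
  | append_singleton m c ih =>
    have hm' : ∀ d ∈ b :: m, d ∈ X := fun d hd => hm d (by
      simp only [List.mem_cons, List.mem_append] at hd ⊢
      tauto)
    have hc : c ∈ X := hm c (by simp)
    have hsum : s + (b :: (m ++ [c])).sum = s + (b :: m).sum + c := by simp [add_assoc]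
    have := generate_normal X π hπ (s + (b :: (m ++ [c])).sum)
    rw [List.map_append, List.map_singleton, iterComm_append_singleton]
    refine commutator_commutator_le_of_rotate ?_ ?_
    · rw [hsum]
      exact (Subgroup.commutator_mono (ih hm' s A hA) le_rfl).trans
        (commutator_generate_le_generate_add X π hπ _ hc)
    · obtain ⟨a, l, hl, rfl, rfl⟩ := hA
      have h := ih hm' ((a :: l).sum + c) ⁅iterComm (π a) (l.map π), π c⁆
        ⟨a, l ++ [c], by
          intro d hd
          simp only [List.mem_cons, List.mem_append, List.not_mem_nil, or_false] at hd hl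
          grind, by simp [add_assoc], by
          rw [List.map_append, List.map_singleton, iterComm_append_singleton]⟩
      convert! h using 2
      rw [hsum]
      exact add_right_comm _ _ _

theorem commutator_generate_generate_le (hπ : ∀ a, (π a).Normal) (s t : M) :
    ⁅generate X π s, generate X π t⁆ ≤ generate X π (s + t) := by
  have := generate_normal X π hπ (s + t)
  refine commutator_generate_le X π fun a l hl hs => ?_
  rw [Subgroup.commutator_comm]
  refine commutator_generate_le X π fun b m hm ht => ?_
  rw [Subgroup.commutator_comm, ← ht]
  exact commutator_iterComm_iterComm_le X π hπ b m hm s _ ⟨a, l, hl, hs, rfl⟩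

end Generate

/-! ### Lexicographic order on pairs -/

section Lex

theorem toLex_le_iff (x y : ℕ ×ₗ ℕ) : x ≤ y ↔ (ofLex x).1 < (ofLex y).1 ∨
    (ofLex x).1 = (ofLex y).1 ∧ (ofLex x).2 ≤ (ofLex y).2 := Prod.Lex.le_iff

theorem fst_lt_of_lt_toLex {s : ℕ} {x : ℕ ×ₗ ℕ} (h : x < toLex (s + 1, 0)) :
    (ofLex x).1 ≤ s := by
  rw [Prod.Lex.lt_iff] at h
  simp at h
  omega

theorem lt_toLex_of_fst_le {s : ℕ} {x : ℕ ×ₗ ℕ} (h : (ofLex x).1 ≤ s) : x < toLex (s + 1, 0) := by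
  rw [Prod.Lex.lt_iff]
  simp
  omega

theorem lex_le_add (x y : ℕ ×ₗ ℕ) : x ≤ x + y := by
  rw [toLex_le_iff]
  simp only [ofLex_add, Prod.fst_add, Prod.snd_add]
  omega

/-- Anything below `z + c`, where the first coordinate of `c` is at most one, is a sum of
something below `z` and something below `c`. -/
theorem exists_add_eq_of_le_add {x z c : ℕ ×ₗ ℕ} (hc : (ofLex c).1 ≤ 1) (h : x ≤ z + c) :
    ∃ z' c', z' ≤ z ∧ c' ≤ c ∧ z' + c' = x := by
  obtain ⟨⟨u, i⟩, rfl⟩ := toLex.surjective x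
  obtain ⟨⟨w, k⟩, rfl⟩ := toLex.surjective z
  obtain ⟨⟨e, j⟩, rfl⟩ := toLex.surjective c
  rw [toLex_le_iff] at h
  simp only [ofLex_add, Prod.fst_add, Prod.snd_add, ofLex_toLex] at h hc
  suffices H : ∃ a b c d : ℕ, toLex (a, b) ≤ toLex (w, k) ∧ toLex (c, d) ≤ toLex (e, j) ∧
      a + c = u ∧ b + d = i by
    obtain ⟨a, b, c, d, h1, h2, rfl, rfl⟩ := H
    exact ⟨_, _, h1, h2, rfl⟩
  simp only [toLex_le_iff, ofLex_toLex]
  by_cases hx : u < w ∨ u = w ∧ i ≤ k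
  · exact ⟨u, i, 0, 0, by omega⟩
  by_cases hu : u = w + e
  · exact ⟨w, min i k, e, i - min i k, by omega⟩
  -- What remains is `e = 1`, `u = w` and `i > k`. The second coordinate exceeds its bound, so a
  -- summand with smaller first coordinate must absorb it.
  rcases Nat.eq_zero_or_pos w with hw | hw
  · exact ⟨0, 0, 0, i, by omega⟩
  · exact ⟨w - 1, i, 1, 0, by omega⟩

end Lex

/-! ### Monotonicity of generated families -/

section Refinement

variable {G : Type*} [Group G]

/-- The filter generated by an antitone family of normal subgroups below `(2, 0)` is antitone. -/
theorem generate_antitone (π : ℕ ×ₗ ℕ → Subgroup G) (hπ : ∀ a, (π a).Normal)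
    (hanti : ∀ x y : ℕ ×ₗ ℕ, x ≤ y → y < toLex (1 + 1, 0) → π y ≤ π x) :
    Antitone (generate {x | x < toLex (1 + 1, 0)} π) := by
  intro x y hxy
  refine generate_le _ π fun a l hl hs => ?_
  subst hs
  induction l using List.reverseRecOn generalizing x with
  | nil =>
    rw [List.sum_singleton] at hxy
    have ha : a < toLex (1 + 1, 0) := hl a (by simp)
    exact (hanti x a hxy ha).trans (le_generate _ π (hxy.trans_lt ha))
  | append_singleton l c ih =>
    have hc : c < toLex (1 + 1, 0) := hl c (by simp)
    have hl' : ∀ b ∈ a :: l, b ∈ {x | x < toLex (1 + 1, 0)} := fun b hb => hl b (by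
      simp only [List.mem_cons, List.mem_append] at hb ⊢
      tauto)
    have hsum : (a :: (l ++ [c])).sum = (a :: l).sum + c := by simp [add_assoc]
    rw [hsum] at hxy
    -- All indices in use have first coordinate at most 1, which is what splitting the bound
    -- requires.
    obtain ⟨z', c', hz, hc', rfl⟩ := exists_add_eq_of_le_add (fst_lt_of_lt_toLex hc) hxy
    rw [List.map_append, List.map_singleton, iterComm_append_singleton]
    exact (Subgroup.commutator_mono (ih hl' hz) (hanti c' c hc' hc)).trans
      (commutator_generate_le_generate_add _ π hπ z' (hc'.trans_lt hc))

end Refinement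


/-! ### The adjoint refinement when `φ₁ = G` -/

namespace NatFilter

variable {G : Type*} [Group G] (φ : NatFilter G) (s : ℕ) [NeZero s]

theorem toLayer_eq_zero_iff (s : ℕ) (x : φ s) : φ.toLayer s x = 0 ↔ (x : G) ∈ φ (s + 1) := by
  refine eq_comm.trans ((φ.toLayer_eq_iff s 1 x).trans ?_)
  simp

theorem H_le (i : ℕ) : φ.H s i ≤ φ s := fun g hg => ((φ.mem_H s i g).1 hg).1

theorem le_H (i : ℕ) : φ (s + 1) ≤ φ.H s i := by
  intro g hg
  have h : g ∈ φ s := φ.antitone (Nat.le_succ s) hg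
  refine (φ.mem_H s i g).2 ⟨h, ?_⟩
  rw [(φ.toLayer_eq_zero_iff s ⟨g, h⟩).2 hg]
  exact zero_mem _

theorem H_antitone : Antitone (φ.H s) := by
  refine antitone_nat_of_succ_le fun i g hg => ?_
  obtain ⟨h, hg⟩ := (φ.mem_H s _ g).1 hg
  refine (φ.mem_H s _ g).2 ⟨h, ?_⟩
  refine AddSubgroup.closure_mono ?_ hg
  rintro w ⟨A, hA, u, rfl⟩
  refine ⟨A, ?_, u, rfl⟩
  exact Ideal.pow_le_pow_right (Nat.le_succ i) hA

/-- `[G, H_i] ≤ [φ₁, φ_s] ≤ φ_{s+1} ≤ H_i`. -/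
theorem H_normal (h1 : φ 1 = ⊤) (i : ℕ) : (φ.H s i).Normal := by
  rw [← Subgroup.commutator_top_left_le_iff]
  refine (Subgroup.commutator_mono h1.ge (φ.H_le s i)).trans
    ((φ.isFilter.commutator_le 1 s).trans ?_)
  rw [add_comm]
  exact φ.le_H s i

theorem lt_H_of_ne_zero {i : ℕ} {w : φ.Layer s} (hw : w ∈ φ.radLayer s i) (h0 : w ≠ 0) :
    φ (s + 1) < φ.H s i := by
  refine lt_of_le_of_ne (φ.le_H s i) fun h => ?_
  obtain ⟨x, rfl⟩ := φ.toLayer_surjective s w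
  refine h0 ((φ.toLayer_eq_zero_iff s x).2 ?_)
  rw [h]
  exact (φ.mem_H s i x).2 ⟨x.2, hw⟩

theorem radLayer_eq_top_of_H_eq {i : ℕ} (h : φ.H s i = φ s) : φ.radLayer s i = ⊤ := by
  refine eq_top_iff.2 fun w _ => ?_
  obtain ⟨x, rfl⟩ := φ.toLayer_surjective s w
  exact ((φ.mem_H s i x).1 (h.ge x.2)).2

theorem H_eq_of_pow_eq_bot {i : ℕ} (h : Ring.jacobson (φ.AdjRing s s) ^ i = ⊥) :
    φ.H s i = φ (s + 1) := by
  refine le_antisymm (fun g hg => ?_) (φ.le_H s i)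
  obtain ⟨hs, hg⟩ := (φ.mem_H s i g).1 hg
  have : φ.radLayer s i ≤ ⊥ := by
    refine (AddSubgroup.closure_le _).2 ?_
    rintro w ⟨A, hA, u, rfl⟩
    rw [h, Ideal.mem_bot] at hA
    rw [hA, map_zero]
    rfl
  exact (φ.toLayer_eq_zero_iff s ⟨g, hs⟩).1 (this hg)

/-- If `L_s J = L_s`, then `L_s Jⁱ = L_s` for all `i`. -/
theorem radLayer_eq_top (h : φ.radLayer s 1 = ⊤) (i : ℕ) : φ.radLayer s i = ⊤ := by
  induction i with
  | zero =>
    refine eq_top_iff.2 fun w _ => AddSubgroup.subset_closure ⟨1, ?_, w, ?_⟩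
    · rw [Submodule.pow_zero, Ideal.one_eq_top]
      trivial
    · rw [map_one]
      rfl
  | succ i ih =>
    rw [eq_top_iff, ← ih]
    refine (AddSubgroup.closure_le _).2 ?_
    rintro w ⟨A, hA, u, rfl⟩
    -- Expand `u` in terms `B v` with `B ∈ J`: then `A u` is a sum of terms `(A * B) v` with `A * B
    -- ∈ J^(i+1)`.
    have hu : u ∈ φ.radLayer s 1 := h ▸ AddSubgroup.mem_top u
    refine AddSubgroup.closure_induction (p := fun u _ => φ.actLeft s s A u ∈
      φ.radLayer s (i + 1)) ?_ ?_ ?_ ?_ hu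
    · rintro _ ⟨B, hB, v, rfl⟩
      rw [Submodule.pow_one] at hB
      refine AddSubgroup.subset_closure ⟨A * B, ?_, v, ?_⟩
      · rw [Submodule.pow_succ]
        exact Ideal.mul_mem_mul hA hB
      · rw [map_mul]
        rfl
    · rw [map_zero]
      exact zero_mem _
    · intro x y _ _ hx hy
      rw [map_add]
      exact add_mem hx hy
    · intro x _ hx
      rw [map_neg]
      exact neg_mem hx

theorem preAdjoint_zero (u : ℕ) : φ.preAdjoint s (toLex (u, 0)) = φ u := if_pos (Or.inl rfl)

theorem preAdjoint_of_ne_zero {i : ℕ} (h : i ≠ 0) :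
    φ.preAdjoint s (toLex (s, i)) = φ.H s i := if_neg (by simp [h])

theorem preAdjoint_le (x : ℕ ×ₗ ℕ) : φ.preAdjoint s x ≤ φ (ofLex x).1 := by
  unfold preAdjoint
  split_ifs with h
  · exact le_rfl
  · push Not at h
    rw [h.2]
    exact φ.H_le s _

theorem le_preAdjoint {x : ℕ ×ₗ ℕ} (h : (ofLex x).1 ≤ s) : φ (s + 1) ≤ φ.preAdjoint s x := by
  unfold preAdjoint
  split_ifs
  · exact φ.antitone (by omega)
  · exact φ.le_H s _

theorem preAdjoint_normal (h1 : φ 1 = ⊤) (x : ℕ ×ₗ ℕ) : (φ.preAdjoint s x).Normal := by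
  unfold preAdjoint
  split_ifs
  · exact φ.normal _
  · exact φ.H_normal s h1 _

/-- If the value at `x` is a term of `φ`, comparing first coordinates suffices. Otherwise `x` lies
in component `s`, and the bound on `y` keeps `y` there too, where the powers of `J` descend. -/
theorem preAdjoint_antitone {x y : ℕ ×ₗ ℕ} (hxy : x ≤ y) (hy : y < toLex (s + 1, 0)) :
    φ.preAdjoint s y ≤ φ.preAdjoint s x := by
  have hy' := fst_lt_of_lt_toLex hy
  by_cases hx : (ofLex x).2 = 0 ∨ (ofLex x).1 ≠ s
  · have h : (ofLex x).1 ≤ (ofLex y).1 := by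
      rw [toLex_le_iff] at hxy
      omega
    rw [preAdjoint, preAdjoint, if_pos hx]
    exact (φ.preAdjoint_le s y).trans (φ.antitone h)
  · have hxy' : ¬((ofLex y).2 = 0 ∨ (ofLex y).1 ≠ s) ∧ (ofLex x).2 ≤ (ofLex y).2 := by
      rw [toLex_le_iff] at hxy
      omega
    rw [preAdjoint, preAdjoint, if_neg hx, if_neg hxy'.1]
    exact φ.H_antitone s hxy'.2

theorem iterComm_preAdjoint_le (a : ℕ ×ₗ ℕ) (l : List (ℕ ×ₗ ℕ)) :
    iterComm (φ.preAdjoint s a) (l.map (φ.preAdjoint s)) ≤ φ (ofLex (a :: l).sum).1 := by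
  induction l using List.reverseRecOn with
  | nil => simpa [iterComm] using φ.preAdjoint_le s a
  | append_singleton l c ih =>
    have hsum : (a :: (l ++ [c])).sum = (a :: l).sum + c := by simp [add_assoc]
    rw [List.map_append, List.map_singleton, iterComm_append_singleton, hsum]
    exact (Subgroup.commutator_mono ih (φ.preAdjoint_le s c)).trans
      (φ.isFilter.commutator_le _ _)

theorem adjointFilter_le (x : ℕ ×ₗ ℕ) : adjointFilter φ s x ≤ φ (ofLex x).1 :=
  generate_le _ _ fun a l _ hs => hs ▸ φ.iterComm_preAdjoint_le s a l

/-- Any product of at least two factors lies in `[G, G] ≤ φ₂`, which is already contained in `π_x`;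
only the one-term sequence matters. -/
theorem adjointFilter_one_eq (h1 : φ 1 = ⊤) {x : ℕ ×ₗ ℕ} (hx : (ofLex x).1 = 1) :
    adjointFilter φ 1 x = φ.preAdjoint 1 x := by
  refine le_antisymm (generate_le _ _ fun a l _ hs => ?_)
    (le_generate _ _ (lt_toLex_of_fst_le hx.le))
  rcases l.eq_nil_or_concat' with rfl | ⟨l, c, rfl⟩
  · rw [List.sum_singleton] at hs
    rw [hs]
    exact le_rfl
  · rw [List.map_append, List.map_singleton, iterComm_append_singleton]
    refine le_trans ?_ (φ.le_preAdjoint 1 hx.le)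
    refine (Subgroup.commutator_mono (le_top.trans h1.ge) (le_top.trans h1.ge)).trans
      (φ.isFilter.commutator_le 1 1)

/-- Suppose `φ₁ = G`. If the radical of the ring of adjoints of `L₁ × L₁ → L₂` is nilpotent and
does not annihilate `L₁`, then the lex-least adjoint refinement is proper. -/
theorem isProperRefinement_adjointFilter (h1 : φ 1 = ⊤)
    (hnil : IsNilpotent (Ring.jacobson (φ.AdjRing 1 1)))
    {A : φ.AdjRing 1 1} (hA : A ∈ Ring.jacobson (φ.AdjRing 1 1)) {u : φ.Layer 1}
    (hu : φ.actLeft 1 1 A u ≠ 0) : IsProperRefinement φ 1 (adjointFilter φ 1) := by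
  have hanti : Antitone (adjointFilter φ 1) :=
    generate_antitone _ (φ.preAdjoint_normal 1 h1) fun _ _ => φ.preAdjoint_antitone 1
  have heq : ∀ u ≤ 1, adjointFilter φ 1 (toLex (u, 0)) = φ u := fun u hu =>
    le_antisymm (φ.adjointFilter_le 1 _) (by
      conv_lhs => rw [← φ.preAdjoint_zero 1 u]
      exact le_generate _ _ (lt_toLex_of_fst_le hu))
  have hH : ∀ i ≠ 0, adjointFilter φ 1 (toLex (1, i)) = φ.H 1 i := fun i hi => by
    rw [φ.adjointFilter_one_eq h1 rfl, φ.preAdjoint_of_ne_zero 1 hi]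
  obtain ⟨c, hc⟩ := hnil
  rw [Ideal.zero_eq_bot] at hc
  have hmem : φ.actLeft 1 1 A u ∈ φ.radLayer 1 1 :=
    AddSubgroup.subset_closure ⟨A, by rwa [Submodule.pow_one], u, rfl⟩
  refine ⟨⟨?_, fun s t => ?_, fun s t => ?_⟩, hanti, fun u i => φ.adjointFilter_le 1 _, heq,
    ⟨c + 1, ?_⟩, 1, ?_, ?_⟩
  · exact (heq 0 zero_le_one).trans φ.isFilter.zero
  · exact commutator_generate_generate_le _ _ (φ.preAdjoint_normal 1 h1) s t
  · refine le_inf (hanti (lex_le_add s t)) (hanti ?_)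
    rw [add_comm]
    exact lex_le_add t s
  -- The index is `c + 1` because `hH` needs a nonzero index and the nilpotency exponent `c` is not
  -- known to be positive.
  · rw [hH _ (Nat.succ_ne_zero c)]
    exact le_antisymm ((φ.H_antitone 1 (Nat.le_succ c)).trans
      (φ.H_eq_of_pow_eq_bot 1 hc).le) (φ.le_H 1 _)
  · rw [hH 1 one_ne_zero]
    exact φ.lt_H_of_ne_zero 1 hmem hu
  · rw [hH 1 one_ne_zero]
    refine lt_of_le_of_ne (φ.H_le 1 1) fun h => hu ?_
    -- If `L₁J = L₁`, then `L₁ = L₁J^c = 0`, contrary to the nonzero element `A u`.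
    have htop := φ.radLayer_eq_top 1 (φ.radLayer_eq_top_of_H_eq 1 h) c
    have hlt := φ.H_eq_of_pow_eq_bot 1 hc
    by_contra hne
    refine (φ.lt_H_of_ne_zero 1 (htop ▸ AddSubgroup.mem_top _ :
      φ.actLeft 1 1 A u ∈ φ.radLayer 1 c) hne).ne hlt.symm

end NatFilter

/-! ### The exponent-`p` central series -/

/-- The bracket `L₁ × L₁ → L₂` of the exponent-`p` central series, as a bilinear map over `ℤ/p`. -/
def etaBracket (p : ℕ) (G : Type*) [Group G] :
    (eta p G).Layer 1 →ₗ[ZMod p] (eta p G).Layer 1 →ₗ[ZMod p] (eta p G).Layer 2 :=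
  AddMonoidHom.toZModLinearMap p
    { toFun := fun u => AddMonoidHom.toZModLinearMap p ((eta p G).bracket 1 1 u)
      map_zero' := by
        rw [map_zero]
        rfl
      map_add' := fun u v => by
        rw [map_add]
        rfl }

theorem etaBracket_apply (p : ℕ) (G : Type*) [Group G] (u v : (eta p G).Layer 1) :
    etaBracket p G u v = (eta p G).bracket 1 1 u v := rfl

end AdjRefine

theorem mainTheorem6 (p : ℕ) [Fact p.Prime] (G : Type*) [Group G] [Finite G] (hG : IsPGroup p G)
    (hodd : Odd (Module.finrank (ZMod p) ((AdjRefine.eta p G).Layer 1)))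
    (htwo : Module.finrank (ZMod p) ((AdjRefine.eta p G).Layer 2) = 2)
    (hcomm : ¬ ⁅AdjRefine.eta p G 1, AdjRefine.eta p G 1⁆ ≤ AdjRefine.eta p G 3) :
    AdjRefine.HasProperLexLeastAdjointRefinement (AdjRefine.eta p G) := by
  open AdjRefine in
  have : Finite ((eta p G).Layer 1) := Finite.of_surjective _ ((eta p G).toLayer_surjective 1)
  have : Finite (AddMonoid.End ((eta p G).Layer 1)) := DFunLike.finite _
  have : Finite ((eta p G).AdjRing 1 1) := by
    have : Finite (AddMonoid.End ((eta p G).Layer 1))ᵐᵒᵖ :=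
      Finite.of_equiv _ MulOpposite.opEquiv
    exact Finite.of_injective _ (Subtype.val_injective (p := (· ∈ (eta p G).Adj 1 1)))
  -- A zero layer would have even dimension, so the first nonzero layer is at 1.
  have htriv : (eta p G) 1 ≠ (eta p G) 2 := by
    intro h
    have : Subsingleton ((eta p G).Layer 1) := by
      refine ⟨fun u v => ?_⟩
      obtain ⟨x, rfl⟩ := (eta p G).toLayer_surjective 1 u
      obtain ⟨y, rfl⟩ := (eta p G).toLayer_surjective 1 v
      rw [((eta p G).toLayer_eq_zero_iff 1 x).2 (h ▸ x.2),
        ((eta p G).toLayer_eq_zero_iff 1 y).2 (h ▸ y.2)]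
    rw [Module.finrank_zero_of_subsingleton] at hodd
    exact absurd hodd (by decide)
  have hb : ∀ v, etaBracket p G v v = 0 := by
    intro v
    obtain ⟨x, rfl⟩ := (eta p G).toLayer_surjective 1 v
    rw [etaBracket_apply, NatFilter.bracket_toLayer]
    refine ((eta p G).toLayer_eq_zero_iff _ _).2 ?_
    have h : (x : G)⁻¹ * (x : G)⁻¹ * x * x = 1 := by group
    simp only [h]
    exact one_mem _
  have hne : etaBracket p G ≠ 0 := by
    intro h
    refine hcomm (Subgroup.commutator_le.2 fun x hx y hy => ?_)
    -- Inverses convert `x⁻¹y⁻¹xy`, used by the bracket, into Mathlib's `xyx⁻¹y⁻¹`.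
    have h0 : (eta p G).bracket 1 1 ((eta p G).toLayer 1 ⟨x, hx⟩⁻¹)
        ((eta p G).toLayer 1 ⟨y, hy⟩⁻¹) = 0 := by
      rw [← etaBracket_apply, h]
      rfl
    rw [NatFilter.bracket_toLayer] at h0
    simpa [commutatorElement_def] using ((eta p G).toLayer_eq_zero_iff _ _).1 h0
  obtain ⟨X, Y, hX, hXY, hsq⟩ := exists_adjoint_pair (etaBracket p G) hb hne hodd htwo
  let N : (eta p G).AdjRing 1 1 :=
    ⟨(X.toAddMonoidHom, MulOpposite.op Y.toAddMonoidHom), hXY⟩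
  have hN : N ∈ Ring.jacobson ((eta p G).AdjRing 1 1) := by
    refine mem_jacobson_of_mul_mul_eq_zero N fun A => ?_
    obtain ⟨h1, h2⟩ := hsq (A.1.1) (A.1.2.unop) A.2
    refine Subtype.ext (Prod.ext ?_ (MulOpposite.unop_injective ?_))
    · exact DFunLike.ext _ _ h1
    · exact DFunLike.ext _ _ h2
  obtain ⟨u, hu⟩ : ∃ u, X u ≠ 0 := by
    by_contra! h
    exact hX (LinearMap.ext h)
  exact ⟨1, inferInstance, ⟨⟨one_ne_zero, htriv⟩, fun t ht => Nat.one_le_iff_ne_zero.2 ht.1⟩,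
    (eta p G).isProperRefinement_adjointFilter rfl (isNilpotent_jacobson_of_finite _) hN
      (u := u) hu⟩
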